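/- **Model.** There are $n$ server queues and $m$ customer queues, with a set $E\subseteq[n]\times[m]$ of compatible pairs. The state in period $k\in\mathbb Z_+$ is $\mathbf q=(\mathbf q^{(1)},\mathbf q^{(2)})\in\mathbb Z_+^n\times\mathbb Z_+^m$. Let $\Omega\subseteq\mathbb R_+^n$ be the set of feasible vectors of server rates, $c:\Omega\to\mathbb R$ the cost of these rates to the operator, and $F_j$ the inverse demand function of customer type $j$. A server pricing is a Borel probability measure $\alpha$ on $\Omega$, with mean rates $\mathbb E_\alpha[\mu_i]$. Fix $A_{\max}\in\mathbb Z_+$. For a server pricing $\alpha$ whose mean rates exist and are at most $A_{\max}$, the vector $\mathbf a^{(1)}$ of server arrivals in one period takes values in $\{0,\dots,A_{\max}\}^n$, and its law depends only on $\alpha$, with mean $(\mathbb E_\alpha[\mu_i])_i$ and covariance matrix $\Sigma^{(1)}(\alpha)$. For customer rates $\boldsymbol\lambda\in[0,A_{\max}]^m$, the vector $\mathbf a^{(2)}$ of customer arrivals takes values in $\{0,\dots,A_{\max}\}^m$, and its law depends only on $\boldsymbol\lambda$, with mean $\boldsymbol\lambda$ and covariance matrix $\Sigma^{(2)}(\boldsymbol\lambda)$.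 Server and customer arrivals in a period are independent of each other; arrivals within one side may be correlated. Server arrivals are stochastically monotone in the mean rates: for any two such pricings $\alpha,\alpha'$ there is a coupling of the arrival vectors $\mathbf a$ (under $\alpha$) and $\mathbf a'$ (under $\alpha'$) such that, almost surely and for all $i\in[n]$, $a_i\ge a'_i$ if $\mathbb E_\alpha[\mu_i]\ge\mathbb E_{\alpha'}[\mu_i]$, and $a_i\le a'_i$ if $\mathbb E_\alpha[\mu_i]\le\mathbb E_{\alpha'}[\mu_i]$. A stationary policy chooses in each state $\mathbf q$ customer rates $\boldsymbol\lambda(\mathbf q)$ and a server pricing $\alpha_{\mathbf q}$ as above and, after the arrivals $\mathbf a$ (conditionally independent of the past given $\mathbf q$), numbers of matches $y_{ij}\in\mathbb Z_+$, a function of $(\mathbf q,\mathbf a)$, with $y_{ij}=0$ for $(i,j)\notin E$, $x^{(1)}_i:=\sum_jy_{ij}\le q^{(1)}_i+a^{(1)}_i$ and $x^{(2)}_j:=\sum_iy_{ij}\le q^{(2)}_j+a^{(2)}_j$. The queue lengths form the Markov chain $\mathbf q(k+1)=\mathbf q(k)+\mathbf a(k)-\mathbf x(k)$, on a closed state space $\mathcal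 S\ni\mathbf 0$. The policy is stable if the communicating class of $\mathbf 0$ is positive recurrent and all other states in $\mathcal S$ are transient; $\bar{\mathbf q}$ denotes a random vector with the stationary distribution. **Fluid problem.** Maximize $\sum_jF_j(\tilde\lambda_j)\tilde\lambda_j-\mathbb E_{\tilde\alpha}[c(\boldsymbol\mu)]$ over $\tilde{\boldsymbol\lambda}\in\mathbb R_+^m$, Borel probability measures $\tilde\alpha$ on $\Omega$ (with integrable rates and cost) and $\tilde{\boldsymbol\chi}\in\mathbb R_+^{n\times m}$ such that $\tilde\lambda_j=\sum_i\tilde\chi_{ij}$, $\mathbb E_{\tilde\alpha}[\mu_i]=\sum_j\tilde\chi_{ij}$, and $\tilde\chi_{ij}=0$ for $(i,j)\notin E$. **Theorem.** Let $(\tilde{\boldsymbol\lambda}^\star,\tilde\alpha^\star,\tilde{\boldsymbol\chi}^\star)$ be an optimal solution of the fluid problem with $\mathbb E_{\tilde\alpha^\star}[\mu_i]\le A_{\max}$ for all $i$, and let $\Sigma^{(2)}_{\min}\in\mathbb R^{m\times m}$. There is $\epsilon_0>0$ such that for every $\epsilon\in(0,\epsilon_0)$ and every stable policy with $$|\lambda_j(\mathbf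 q)-\tilde\lambda^\star_j|\le\epsilon,\qquad |\mathbb E_{\alpha_{\mathbf q}}[\mu_i]-\mathbb E_{\tilde\alpha^\star}[\mu_i]|\le\epsilon,\qquad \Sigma^{(2)}_{\min}\le\Sigma^{(2)}(\boldsymbol\lambda(\mathbf q))\ \text{(entrywise)}$$ for all $\mathbf q\in\mathcal S$, $i\in[n]$, $j\in[m]$, the expected total steady-state queue length (possibly $+\infty$) satisfies $$\mathbb E\Big[\sum_{i=1}^n\bar q^{(1)}_i+\sum_{j=1}^m\bar q^{(2)}_j\Big]\ \ge\ \frac{\sum_{i,k=1}^n\Sigma^{(1)}(\tilde\alpha^\star)_{ik}+\sum_{j,l=1}^m(\Sigma^{(2)}_{\min})_{jl}}{8\max\{m,n\}\,\epsilon}.$$ -/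

import Mathlib

open scoped ENNReal BigOperators
open MeasureTheory ProbabilityTheory

noncomputable section

/-! ### Discrete time Markov chains on a countable state space -/

namespace DTMC

variable {X : Type*}

/-- The law of the chain after `k` steps from `x`, for the one-step kernel `P`. -/
def nStep (P : X → PMF X) : ℕ → X → PMF X
  | 0, x => PMF.pure x
  | k + 1, x => (P x).bind (nStep P k)

/-- `x` and `y` communicate: each is reached from the other with positive probability. -/
def Communicates (P : X → PMF X) (x y : X) : Prop :=
  (∃ k, nStep P k x y ≠ 0) ∧ ∃ k, nStep P k y x ≠ 0

open Classical in
/-- `firstHit P y k x` is the probability, starting from `x`, that the first visit to `y` at a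
strictly positive time happens at time `k + 1`. -/
def firstHit (P : X → PMF X) (y : X) : ℕ → X → ℝ≥0∞
  | 0, x => P x y
  | k + 1, x => ∑' z, if z = y then 0 else P x z * firstHit P y k z

/-- `x` is positive recurrent: the return time to `x` is almost surely finite, with finite mean. -/
def PositiveRecurrent (P : X → PMF X) (x : X) : Prop :=
  ∑' k, firstHit P x k x = 1 ∧ ∑' k : ℕ, ((k : ℝ≥0∞) + 1) * firstHit P x k x ≠ ∞

/-- `x` is transient: with positive probability the chain never returns to `x`. -/
def Transient (P : X → PMF X) (x : X) : Prop :=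
  ∑' k, firstHit P x k x < 1

/-- The chain with kernel `P`, run on the state space `S`, is stable with respect to the state `o`:
the communicating class of `o` is positive recurrent and all other states are transient. -/
structure StableOn (P : X → PMF X) (S : Set X) (o : X) : Prop where
  mem : o ∈ S
  closed : ∀ x ∈ S, (P x).support ⊆ S
  positiveRecurrent : ∀ x ∈ S, Communicates P o x → PositiveRecurrent P x
  transient : ∀ x ∈ S, ¬ Communicates P o x → Transient P x

/-- `ψ` is a stationary distribution, carried by the state space `S`. -/
def IsStationaryOn (P : X → PMF X) (S : Set X) (ψ : PMF X) : Prop :=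
  ψ.support ⊆ S ∧ ψ.bind P = ψ

end DTMC

/-! ### Means and covariances of vectors of counts -/

/-- The mean vector of a random vector of counts with law `p`. -/
def meanVec {ι : Type*} [Fintype ι] (p : PMF (ι → ℕ)) (i : ι) : ℝ :=
  ∫ a, (a i : ℝ) ∂p.toMeasure

/-- The covariance matrix of a random vector of counts with law `p`. -/
def covMatrix {ι : Type*} [Fintype ι] (p : PMF (ι → ℕ)) : Matrix ι ι ℝ :=
  Matrix.of fun i k => cov[fun a : ι → ℕ => (a i : ℝ), fun a : ι → ℕ => (a k : ℝ); p.toMeasure]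

/-- The sum of the entries of the Hadamard product of two matrices. -/
def hadamardSum {ι κ : Type*} [Fintype ι] [Fintype κ] (A B : Matrix ι κ ℝ) : ℝ :=
  ∑ i, ∑ k, A i k * B i k

/-- The matrix all of whose entries are one. -/
def onesMatrix (ι κ : Type*) : Matrix ι κ ℝ := Matrix.of fun _ _ => 1

/-! ### The server side: feasible rates and their cost -/

/-- The server side of the market with `n` server queues: the set `Ω` of feasible vectors of
effective arrival rates, and the cost to the operator of each of them. -/
structure ServerMarket (n : ℕ) where
  rates : Set (Fin n → ℝ)
  rates_nonneg : ∀ μ ∈ rates, ∀ i, 0 ≤ μ i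
  cost : rates → ℝ

/-- The price vectors consistent with the effective rates `μ`, when a type `i` server who joins
queue `l` has utility `f i l p` and the inverse supply curve of type `i` is `G i`. Here `ν i l` is
the probability that a type `i` server joins queue `l` (an equilibrium), and `μhat i` is the rate
at which type `i` servers join the system. -/
def consistentPrices {n : ℕ} (f : Fin n → Fin n → (Fin n → ℝ) → ℝ) (G : Fin n → ℝ → ℝ)
    (μ : Fin n → ℝ) : Set (Fin n → ℝ) :=
  {p | (∀ i, 0 ≤ p i) ∧ ∃ (ν : Fin n → Fin n → ℝ) (μhat : Fin n → ℝ),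
    (∀ i, ν i ∈ stdSimplex ℝ (Fin n)) ∧ (∀ i, 0 ≤ μhat i) ∧
    (∀ i l, 0 < ν i l → ∀ l', f i l' p ≤ f i l p) ∧
    (∀ i, G i (μhat i) = ⨆ l, f i l p) ∧
    (∀ i, μ i = ∑ l, μhat l * ν l i)}

/-- The market with selfish servers: `Ω` is the set of rates that some price vector induces in
equilibrium, and the cost of `μ ∈ Ω` is the least payment `⟨μ, p⟩` over the consistent prices.
This is the basic example of a `ServerMarket`; other models of the behaviour of the servers give
other sets of rates and other cost functions. -/
def ServerMarket.selfish {n : ℕ} (f : Fin n → Fin n → (Fin n → ℝ) → ℝ) (G : Fin n → ℝ → ℝ) :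
    ServerMarket n where
  rates := {μ | (consistentPrices f G μ).Nonempty}
  rates_nonneg := by
    rintro μ ⟨p, -, ν, μhat, hν, hμ, -, -, h⟩ i
    rw [h i]
    exact Finset.sum_nonneg fun l _ => mul_nonneg (hμ l) ((hν l).1 i)
  cost μ := sInf ((fun p => ∑ i, (μ : Fin n → ℝ) i * p i) '' consistentPrices f G μ)

variable {n m : ℕ}

/-- The mean server rate `E_α[μ_i]` under a randomized server pricing `α` (a Borel probability
measure on the set of feasible rates). -/
def meanRate {M : ServerMarket n} (α : ProbabilityMeasure M.rates) (i : Fin n) : ℝ :=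
  ∫ μ, (μ : Fin n → ℝ) i ∂(α : Measure M.rates)

/-- A randomized server pricing that can be realized by at most `A` arrivals per queue and period:
its mean rates exist and do not exceed `A`. -/
def ServerAttainable (A : ℕ) {M : ServerMarket n} (α : ProbabilityMeasure M.rates) : Prop :=
  ∀ i, Integrable (fun μ : M.rates => (μ : Fin n → ℝ) i) (α : Measure M.rates) ∧ meanRate α i ≤ A

/-- A vector of customer rates that can be realized by at most `A` arrivals per type and period. -/
def CustomerAttainable (A : ℕ) (lam : Fin m → ℝ) : Prop :=
  ∀ j, 0 ≤ lam j ∧ lam j ≤ A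

/-! ### The fluid problem -/

/-- `(lam, α, χ)` is feasible in the probabilistic fluid problem with compatibility graph `E`. -/
structure FluidFeasible (M : ServerMarket n) (E : Set (Fin n × Fin m)) (lam : Fin m → ℝ)
    (α : ProbabilityMeasure M.rates) (χ : Fin n → Fin m → ℝ) : Prop where
  lam_nonneg : ∀ j, 0 ≤ lam j
  rates_integrable :
    ∀ i, Integrable (fun μ : M.rates => (μ : Fin n → ℝ) i) (α : Measure M.rates)
  cost_integrable : Integrable M.cost (α : Measure M.rates)
  customer_balance : ∀ j, lam j = ∑ i, χ i j
  server_balance : ∀ i, meanRate α i = ∑ j, χ i j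
  flow_nonneg : ∀ i j, 0 ≤ χ i j
  flow_eq_zero : ∀ i j, (i, j) ∉ E → χ i j = 0

/-- The fluid profit `⟨F(lam), lam⟩ - E_α[c(μ)]`. -/
def fluidProfit (F : Fin m → ℝ → ℝ) (M : ServerMarket n) (lam : Fin m → ℝ)
    (α : ProbabilityMeasure M.rates) : ℝ :=
  ∑ j, F j (lam j) * lam j - ∫ μ, M.cost μ ∂(α : Measure M.rates)

/-- `(lam, α, χ)` is an optimal solution of the probabilistic fluid problem. -/
def FluidOptimal (F : Fin m → ℝ → ℝ) (M : ServerMarket n) (E : Set (Fin n × Fin m))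
    (lam : Fin m → ℝ) (α : ProbabilityMeasure M.rates) (χ : Fin n → Fin m → ℝ) : Prop :=
  FluidFeasible M E lam α χ ∧
    ∀ lam' α' χ', FluidFeasible M E lam' α' χ' → fluidProfit F M lam' α' ≤ fluidProfit F M lam α

/-! ### Arrivals -/

/-- The stochastic arrivals: for each randomized server pricing the law of the vector of server
arrivals in one period, and for each vector of customer rates the law of the vector of customer
arrivals in one period. Arrivals are integers, at most `A` in each queue, their means are the
posted rates, and they may be correlated across the queues of one side. -/
structure ArrivalModel (M : ServerMarket n) (m : ℕ) (A : ℕ) where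
  server : ProbabilityMeasure M.rates → PMF (Fin n → ℕ)
  customer : (Fin m → ℝ) → PMF (Fin m → ℕ)
  server_le : ∀ α, ServerAttainable A α → ∀ a ∈ (server α).support, ∀ i, a i ≤ A
  server_mean : ∀ α, ServerAttainable A α → ∀ i, meanVec (server α) i = meanRate α i
  customer_le : ∀ lam, CustomerAttainable A lam → ∀ a ∈ (customer lam).support, ∀ j, a j ≤ A
  customer_mean : ∀ lam, CustomerAttainable A lam → ∀ j, meanVec (customer lam) j = lam j

/-- Stochastic monotonicity of the vector of server arrivals in the mean rates. For any two
pricings there is one coupling `ρ` of the two arrival vectors under which, in each queue `i`, the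
pricing with the larger mean rate has the larger number of arrivals almost surely. In each single
queue this gives stochastic dominance in the usual sense. -/
def ArrivalModel.ServerMonotone {M : ServerMarket n} {A : ℕ} (arr : ArrivalModel M m A) : Prop :=
  ∀ α α' : ProbabilityMeasure M.rates, ServerAttainable A α → ServerAttainable A α' →
    ∃ ρ : PMF ((Fin n → ℕ) × (Fin n → ℕ)),
      ρ.map Prod.fst = arr.server α ∧ ρ.map Prod.snd = arr.server α' ∧
      ∀ w ∈ ρ.support, ∀ i,
        (meanRate α i ≤ meanRate α' i → w.1 i ≤ w.2 i) ∧
        (meanRate α' i ≤ meanRate α i → w.2 i ≤ w.1 i)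

/-! ### Policies and the queueing dynamics -/

/-- The queue lengths (or arrivals) of the `n` server queues and the `m` customer queues. -/
abbrev QState (n m : ℕ) : Type := (Fin n → ℕ) × (Fin m → ℕ)

/-- A stationary Markovian pricing and matching policy on the compatibility graph `E`.
`matching q a i j` is the number of servers in queue `i` that are matched with customers in
queue `j` when the queue lengths are `q` and the arrivals are `a`. -/
structure Policy (M : ServerMarket n) (E : Set (Fin n × Fin m)) (A : ℕ) where
  customerRate : QState n m → Fin m → ℝ
  serverPricing : QState n m → ProbabilityMeasure M.rates
  matching : QState n m → QState n m → Fin n → Fin m → ℕ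
  customer_attainable : ∀ q, CustomerAttainable A (customerRate q)
  server_attainable : ∀ q, ServerAttainable A (serverPricing q)
  server_matched_le : ∀ q a i, ∑ j, matching q a i j ≤ q.1 i + a.1 i
  customer_matched_le : ∀ q a j, ∑ i, matching q a i j ≤ q.2 j + a.2 j
  compatible : ∀ q a i j, (i, j) ∉ E → matching q a i j = 0

namespace Policy

variable {M : ServerMarket n} {E : Set (Fin n × Fin m)} {A : ℕ}

/-- The law of the arrivals in state `q`: server and customer arrivals are independent. -/
def arrivalLaw (π : Policy M E A) (arr : ArrivalModel M m A) (q : QState n m) :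
    PMF (QState n m) :=
  (arr.server (π.serverPricing q)).bind fun a₁ =>
    (arr.customer (π.customerRate q)).map fun a₂ => (a₁, a₂)

/-- The queue lengths `q + a - x` after arrivals and matching. The subtraction does not truncate,
by the feasibility of the matching. -/
def next (π : Policy M E A) (q a : QState n m) : QState n m :=
  (fun i => q.1 i + a.1 i - ∑ j, π.matching q a i j,
   fun j => q.2 j + a.2 j - ∑ i, π.matching q a i j)

/-- The transition kernel of the chain of queue lengths. -/
def kernel (π : Policy M E A) (arr : ArrivalModel M m A) (q : QState n m) : PMF (QState n m) :=
  (π.arrivalLaw arr q).map (π.next q)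

/-- The policy is stable on the state space `S`. -/
def Stable (π : Policy M E A) (arr : ArrivalModel M m A) (S : Set (QState n m)) : Prop :=
  DTMC.StableOn (π.kernel arr) S 0

end Policy

/-- The expected total queue length, with values in `[0, ∞]`, for queue lengths with law `ψ`. -/
def expectedTotalQueue (ψ : PMF (QState n m)) : ℝ≥0∞ :=
  ∑' q, ψ q * ((∑ i, (q.1 i : ℝ≥0∞)) + ∑ j, (q.2 j : ℝ≥0∞))

end

/-!
Matching removes one server and one customer at a time, so the imbalance `z`, the total server
queue minus the total customer queue, moves by server arrivals minus customer arrivals whatever the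
matching does (`Policy.imbalance_next`). Since the fluid solution is balanced
(`FluidFeasible.sum_meanRate_eq`), rates within `ε` of it give `z` a drift of at most `(n + m) ε` in
absolute value, while the second moment of a step of `z` is at least the sum of the variances of the
two totals of arrivals (`Policy.variance_le_integral_imbalance_step_sq`). A monotone coupling shows
that the variance of the server total is Lipschitz in the mean rates
(`variance_totalCount_le_of_coupling`), so for small `ε` the second moment is at least half the
numerator of the bound.

If `z` had a finite second moment, then equating `E[z ^ 2]` before and after one step would give
`E[step ^ 2] ≤ 2 (n + m) ε E|z|`, and `|z|` is at most the total queue length. Only `E|z| < ∞` may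
be assumed, since otherwise the claim is trivial. So `z ^ 2` is replaced by the Huber function,
which grows linearly and hence is integrable. Its increments are bounded below by convexity, and
equal those of `z ^ 2` below the threshold (`huber_add_ge`); then the threshold is sent to infinity
(`PMF.div_two_mul_le_mean_abs_of_bind_eq`). Apart from stationarity of the law, no recurrence
property of the chain is needed.
-/

/-! ### Integrals of functions that are bounded on the support of a discrete law -/

section DiscreteLaws

lemma PMF.tsum_bind_mul {X Y : Type*} (ψ : PMF Y) (P : Y → PMF X) (h : X → ℝ≥0∞) :
    ∑' y, (ψ.bind P) y * h y = ∑' x, ψ x * ∑' y, P x y * h y := by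
  simp_rw [PMF.bind_apply, ← ENNReal.tsum_mul_right, ← ENNReal.tsum_mul_left]
  rw [ENNReal.tsum_comm]
  simp_rw [mul_assoc]

variable {X : Type*} [MeasurableSpace X] [Countable X] [MeasurableSingletonClass X]

lemma PMF.ae_mem_support (p : PMF X) : ∀ᵐ a ∂p.toMeasure, a ∈ p.support := by
  have h : p.toMeasure p.supportᶜ = 0 :=
    (p.toMeasure_apply_eq_zero_iff .of_discrete).2 disjoint_compl_right
  exact h

lemma PMF.memLp_of_bounded (p : PMF X) (f : X → ℝ) (C : ℝ) (r : ℝ≥0∞)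
    (h : ∀ a ∈ p.support, |f a| ≤ C) : MemLp f r p.toMeasure :=
  MemLp.of_bound Measurable.of_discrete.aestronglyMeasurable C
    (p.ae_mem_support.mono fun a ha => h a ha)

lemma PMF.integrable_of_bounded (p : PMF X) (f : X → ℝ) (C : ℝ)
    (h : ∀ a ∈ p.support, |f a| ≤ C) : Integrable f p.toMeasure :=
  memLp_one_iff_integrable.1 (p.memLp_of_bounded f C 1 h)

lemma PMF.lintegral_eq_tsum_mul (p : PMF X) (f : X → ℝ≥0∞) :
    ∫⁻ a, f a ∂p.toMeasure = ∑' a, p a * f a := by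
  rw [lintegral_countable']
  refine tsum_congr fun a => ?_
  rw [p.toMeasure_apply_singleton a (measurableSet_singleton a), mul_comm]

lemma PMF.toMeasure_bind_map_mk {Y : Type*} [MeasurableSpace Y] [Countable Y]
    [MeasurableSingletonClass Y] (p : PMF X) (r : PMF Y) :
    (p.bind fun a => r.map fun b => (a, b)).toMeasure = p.toMeasure.prod r.toMeasure := by
  classical
  refine Measure.ext_of_singleton fun w => ?_
  obtain ⟨a, b⟩ := w
  rw [PMF.toMeasure_apply_singleton _ _ (measurableSet_singleton _),
    ← Set.singleton_prod_singleton, Measure.prod_prod,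
    PMF.toMeasure_apply_singleton _ _ (measurableSet_singleton _),
    PMF.toMeasure_apply_singleton _ _ (measurableSet_singleton _), PMF.bind_apply,
    tsum_eq_single a]
  · congr 1
    rw [PMF.map_apply, tsum_eq_single b] <;> simp +contextual [eq_comm]
  · intro a' ha'
    rw [PMF.map_apply]
    simp [ha'.symm]

end DiscreteLaws

/-! ### A quadratic test function of linear growth -/

/-- The Huber function with threshold `K`: it is `z ^ 2` on `[-K, K]` and is continued linearly
with slope `± 2 * K` outside that interval. -/
noncomputable def huber (K z : ℝ) : ℝ := if |z| ≤ K then z ^ 2 else 2 * K * |z| - K ^ 2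

/-- The derivative of the Huber function with threshold `K`. -/
noncomputable def huberSlope (K z : ℝ) : ℝ := max (-(2 * K)) (min (2 * z) (2 * K))

/-- The Huber function is the Legendre transform of `s ↦ s ^ 2 / 4` on `[-2 * K, 2 * K]`; this is
the half of that fact which expresses convexity. -/
lemma mul_sub_sq_le_huber {K s : ℝ} (hs : |s| ≤ 2 * K) (w : ℝ) :
    s * w - s ^ 2 / 4 ≤ huber K w := by
  unfold huber
  split_ifs with hw
  · nlinarith [sq_nonneg (w - s / 2)]
  · have h1 : s * w ≤ |s| * |w| := by rw [← abs_mul]; exact le_abs_self _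
    rw [← sq_abs s]
    nlinarith [mul_nonneg (sub_nonneg.2 hs) (sub_nonneg.2 (not_le.1 hw).le),
      sq_nonneg (2 * K - |s|)]

lemma huber_eq_slope {K : ℝ} (hK : 0 ≤ K) (z : ℝ) :
    huber K z = huberSlope K z * z - huberSlope K z ^ 2 / 4 := by
  unfold huber huberSlope
  split_ifs with hz
  · rw [abs_le] at hz
    rw [min_eq_left (by linarith), max_eq_right (by linarith)]; ring
  · rw [not_le, lt_abs] at hz
    rcases hz with h | h
    · rw [min_eq_right (by linarith), max_eq_right (by linarith), abs_of_pos (by linarith)]; ring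
    · rw [min_eq_left (by linarith), max_eq_left (by linarith), abs_of_neg (by linarith)]; ring

lemma abs_huberSlope_le {K : ℝ} (hK : 0 ≤ K) (z : ℝ) : |huberSlope K z| ≤ 2 * K := by
  unfold huberSlope
  exact abs_le.2 ⟨le_max_left _ _, max_le (by linarith) (min_le_right _ _)⟩

lemma abs_huberSlope_le_abs {K : ℝ} (hK : 0 ≤ K) (z : ℝ) : |huberSlope K z| ≤ 2 * |z| := by
  unfold huberSlope
  have h1 := neg_abs_le z
  have h2 := le_abs_self z
  have h3 := abs_nonneg z
  refine abs_le.2 ⟨le_max_of_le_right (le_min (by linarith) (by linarith)),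
    max_le (by linarith) ((min_le_left _ _).trans (by linarith))⟩

lemma huber_nonneg {K : ℝ} (hK : 0 ≤ K) (z : ℝ) : 0 ≤ huber K z := by
  simpa using mul_sub_sq_le_huber (K := K) (s := 0) (by simpa using hK) z

lemma huber_le_mul_abs {K : ℝ} (z : ℝ) : huber K z ≤ 2 * K * |z| := by
  unfold huber
  split_ifs with h
  · rw [← sq_abs]; nlinarith [abs_nonneg z]
  · nlinarith

/-- Second order lower bound for the increments of the Huber function. Convexity alone gives the
bound without the quadratic term, and the quadratic term is positive only where the function is
exactly quadratic. -/
lemma huber_add_ge {B L : ℝ} (hB : 0 ≤ B) (hL : 0 < L) {z x : ℝ} (hx : |x| ≤ B) :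
    huber (L + B) z + (huberSlope (L + B) z * x + x ^ 2 * (1 - |z| / L)) ≤
      huber (L + B) (z + x) := by
  by_cases hz : |z| ≤ L
  · have h1 : |z + x| ≤ L + B := (abs_add_le z x).trans (add_le_add hz hx)
    have h2 : |z| ≤ L + B := by linarith
    have h3 : huberSlope (L + B) z = 2 * z := by
      rw [abs_le] at h2
      unfold huberSlope
      rw [min_eq_left (by linarith), max_eq_right (by linarith)]
    rw [h3, huber, huber, if_pos h1, if_pos h2]
    have : 0 ≤ x ^ 2 * (|z| / L) := by positivity
    nlinarith
  · have hK : 0 ≤ L + B := by linarith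
    have h1 := mul_sub_sq_le_huber (abs_huberSlope_le hK z) (z + x)
    have h2 := huber_eq_slope hK z
    have h3 : 1 ≤ |z| / L := (one_le_div hL).2 (not_le.1 hz).le
    nlinarith [mul_nonneg (sq_nonneg x) (sub_nonneg.2 h3)]

/-! ### Drift and variance of a function of a stationary chain -/

section Drift

variable {X : Type*} [MeasurableSpace X] [Countable X] [MeasurableSingletonClass X]

/-- The expected increment of the Huber function along a bounded step `D` with mean at most `d` in
absolute value and second moment at least `v`. -/
lemma huber_drift (p : PMF X) (D : X → ℝ) {B L d v : ℝ} (hB : 0 ≤ B) (hL : 0 < L)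
    (hD : ∀ a ∈ p.support, |D a| ≤ B) (hd : |∫ a, D a ∂p.toMeasure| ≤ d)
    (hv : v ≤ ∫ a, D a ^ 2 ∂p.toMeasure) (z : ℝ) :
    huber (L + B) z + v ≤
      ∫ a, huber (L + B) (z + D a) ∂p.toMeasure + (2 * d + B ^ 2 / L) * |z| := by
  have hK : 0 ≤ L + B := by linarith
  set g := huberSlope (L + B) z
  have i1 : Integrable D p.toMeasure := p.integrable_of_bounded D B hD
  have hsq : ∀ a ∈ p.support, D a ^ 2 ≤ B ^ 2 := fun a ha => by
    rw [← sq_abs]; exact pow_le_pow_left₀ (abs_nonneg _) (hD a ha) 2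
  have i2 : Integrable (fun a => D a ^ 2) p.toMeasure :=
    p.integrable_of_bounded _ (B ^ 2) fun a ha => by
      rw [abs_of_nonneg (sq_nonneg _)]; exact hsq a ha
  have i3 : Integrable (fun a => huber (L + B) (z + D a)) p.toMeasure :=
    p.integrable_of_bounded _ (2 * (L + B) * (|z| + B)) fun a ha => by
      rw [abs_of_nonneg (huber_nonneg hK _)]
      refine (huber_le_mul_abs _).trans (mul_le_mul_of_nonneg_left ?_ (by positivity))
      exact (abs_add_le _ _).trans (add_le_add_right (hD a ha) _)
  have hint : ∫ a, (huber (L + B) z + (g * D a + D a ^ 2 * (1 - |z| / L))) ∂p.toMeasure ≤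
      ∫ a, huber (L + B) (z + D a) ∂p.toMeasure := by
    refine integral_mono_ae ?_ i3 (p.ae_mem_support.mono fun a ha => huber_add_ge hB hL (hD a ha))
    exact (integrable_const _).add ((i1.const_mul g).add (i2.mul_const _))
  have i4 : Integrable (fun a => g * D a) p.toMeasure := i1.const_mul g
  have i5 : Integrable (fun a => D a ^ 2 * (1 - |z| / L)) p.toMeasure := i2.mul_const _
  have i6 : Integrable (fun a => g * D a + D a ^ 2 * (1 - |z| / L)) p.toMeasure := i4.add i5
  rw [integral_add (integrable_const _) i6, integral_add i4 i5, integral_const_mul,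
    integral_mul_const] at hint
  simp only [integral_const, probReal_univ, one_smul] at hint
  set s := ∫ a, D a ^ 2 ∂p.toMeasure
  have hsB : s ≤ B ^ 2 := by
    have := integral_mono_ae i2 (integrable_const (B ^ 2)) (p.ae_mem_support.mono hsq)
    simpa using this
  have hgd : -(2 * |z| * d) ≤ g * ∫ a, D a ∂p.toMeasure := by
    have : |g * ∫ a, D a ∂p.toMeasure| ≤ 2 * |z| * d := by
      rw [abs_mul]
      exact mul_le_mul (abs_huberSlope_le_abs hK z) hd (abs_nonneg _) (by positivity)
    exact (abs_le.1 this).1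
  have hzL : 0 ≤ |z| / L := by positivity
  have : s * (|z| / L) ≤ B ^ 2 / L * |z| := by
    calc s * (|z| / L) ≤ B ^ 2 * (|z| / L) := mul_le_mul_of_nonneg_right hsB hzL
      _ = B ^ 2 / L * |z| := by ring
  linarith

/-- In stationarity, a real function of the chain whose steps are bounded, have mean at most `d` in
absolute value and second moment at least `v`, has a mean absolute value of at least `v / (2 d)`.
No moment of `z` is assumed to be finite. -/
theorem PMF.div_two_mul_le_mean_abs_of_bind_eq (P : X → PMF X) (ψ : PMF X) (hψ : ψ.bind P = ψ)
    (z : X → ℝ) {B d v : ℝ} (hB : 0 ≤ B) (hd0 : 0 < d)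
    (hD : ∀ x ∈ ψ.support, ∀ y ∈ (P x).support, |z y - z x| ≤ B)
    (hd : ∀ x ∈ ψ.support, |∫ y, (z y - z x) ∂(P x).toMeasure| ≤ d)
    (hv : ∀ x ∈ ψ.support, v ≤ ∫ y, (z y - z x) ^ 2 ∂(P x).toMeasure) (hv0 : 0 ≤ v) :
    ENNReal.ofReal (v / (2 * d)) ≤ ∑' x, ψ x * ENNReal.ofReal |z x| := by
  set T := ∑' x, ψ x * ENNReal.ofReal |z x| with hT
  by_cases hTtop : T = ∞
  · rw [hTtop]; exact le_top
  have key : ∀ L : ℝ, 0 < L → v ≤ (2 * d + B ^ 2 / L) * T.toReal := by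
    intro L hL
    have hK : 0 ≤ L + B := by linarith
    set h : X → ℝ≥0∞ := fun x => ENNReal.ofReal (huber (L + B) (z x)) with hh
    set H := ∑' x, ψ x * h x with hH
    have hc : 0 ≤ 2 * d + B ^ 2 / L := by positivity
    have hHfin : H ≠ ∞ := by
      refine ne_top_of_le_ne_top (ENNReal.mul_ne_top (ENNReal.ofReal_ne_top (r := 2 * (L + B)))
        hTtop) ?_
      rw [hT, ← ENNReal.tsum_mul_left]
      refine ENNReal.tsum_le_tsum fun x => ?_
      rw [mul_left_comm, ← ENNReal.ofReal_mul (by positivity)]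
      gcongr
      exact ENNReal.ofReal_le_ofReal (huber_le_mul_abs _)
    have hstep : ∀ x ∈ ψ.support, h x + ENNReal.ofReal v ≤
        ∑' y, P x y * h y + ENNReal.ofReal (2 * d + B ^ 2 / L) * ENNReal.ofReal |z x| := by
      intro x hx
      have hdr := huber_drift (P x) (fun y => z y - z x) hB hL (hD x hx) (hd x hx) (hv x hx) (z x)
      simp only [add_sub_cancel] at hdr
      have hi : ∑' y, P x y * h y =
          ENNReal.ofReal (∫ y, huber (L + B) (z y) ∂(P x).toMeasure) := by
        rw [← PMF.lintegral_eq_tsum_mul, ofReal_integral_eq_lintegral_ofReal]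
        · refine (P x).integrable_of_bounded _ (2 * (L + B) * (|z x| + B)) fun y hy => ?_
          rw [abs_of_nonneg (huber_nonneg hK _)]
          refine (huber_le_mul_abs _).trans (mul_le_mul_of_nonneg_left ?_ (by positivity))
          have := abs_sub_abs_le_abs_sub (z y) (z x)
          linarith [hD x hx y hy]
        · exact Filter.Eventually.of_forall fun y => huber_nonneg hK _
      have hpos : 0 ≤ ∫ y, huber (L + B) (z y) ∂(P x).toMeasure :=
        integral_nonneg fun y => huber_nonneg hK _
      rw [hi, hh, ← ENNReal.ofReal_mul hc, ← ENNReal.ofReal_add (huber_nonneg hK _) hv0,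
        ← ENNReal.ofReal_add hpos (by positivity)]
      exact ENNReal.ofReal_le_ofReal hdr
    have hsum : H + ENNReal.ofReal v ≤ H + ENNReal.ofReal (2 * d + B ^ 2 / L) * T := by
      have h1 : H + ENNReal.ofReal v = ∑' x, ψ x * (h x + ENNReal.ofReal v) := by
        simp_rw [mul_add]
        rw [ENNReal.tsum_add, ENNReal.tsum_mul_right, ψ.tsum_coe, one_mul]
      have h2 : H + ENNReal.ofReal (2 * d + B ^ 2 / L) * T =
          ∑' x, ψ x * (∑' y, P x y * h y +
            ENNReal.ofReal (2 * d + B ^ 2 / L) * ENNReal.ofReal |z x|) := by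
        simp_rw [mul_add]
        rw [ENNReal.tsum_add, ← PMF.tsum_bind_mul, hψ, hT, ← ENNReal.tsum_mul_left]
        simp_rw [mul_left_comm]
        rfl
      rw [h1, h2]
      refine ENNReal.tsum_le_tsum fun x => ?_
      by_cases hx : x ∈ ψ.support
      · exact mul_le_mul_right (hstep x hx) _
      · rw [(ψ.apply_eq_zero_iff x).2 hx, zero_mul, zero_mul]
    have hfin := (ENNReal.add_le_add_iff_left hHfin).1 hsum
    rw [← ENNReal.ofReal_toReal hTtop, ← ENNReal.ofReal_mul hc] at hfin
    exact (ENNReal.ofReal_le_ofReal_iff (mul_nonneg hc ENNReal.toReal_nonneg)).1 hfin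
  have hlim : Filter.Tendsto (fun L : ℝ => (2 * d + B ^ 2 / L) * T.toReal) Filter.atTop
      (nhds ((2 * d + 0) * T.toReal)) :=
    (tendsto_const_nhds.add (tendsto_const_nhds.div_atTop Filter.tendsto_id)).mul_const _
  have hle : v ≤ (2 * d + 0) * T.toReal :=
    ge_of_tendsto hlim ((Filter.eventually_gt_atTop 0).mono key)
  rw [← ENNReal.ofReal_toReal hTtop]
  refine ENNReal.ofReal_le_ofReal ((div_le_iff₀ (by positivity)).2 ?_)
  linarith

end Drift

/-! ### Total arrivals: variance, and its continuity along a monotone coupling -/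

section Totals

variable {ι : Type*} [Fintype ι]

/-- The total number of arrivals in a vector of counts, as a real number. -/
def totalCount (a : ι → ℕ) : ℝ := ∑ i, (a i : ℝ)

lemma totalCount_nonneg (a : ι → ℕ) : 0 ≤ totalCount a :=
  Finset.sum_nonneg fun _ _ => Nat.cast_nonneg _

lemma totalCount_le {A : ℕ} {a : ι → ℕ} (h : ∀ i, a i ≤ A) :
    totalCount a ≤ Fintype.card ι * A := by
  have := Finset.sum_le_card_nsmul Finset.univ (fun i => (a i : ℝ)) A fun i _ => by
    exact_mod_cast h i
  simpa [totalCount] using this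

lemma abs_totalCount_le {A : ℕ} {a : ι → ℕ} (h : ∀ i, a i ≤ A) :
    |totalCount a| ≤ Fintype.card ι * A := by
  rw [abs_of_nonneg (totalCount_nonneg a)]; exact totalCount_le h

lemma integral_totalCount {p : PMF (ι → ℕ)} {A : ℕ} (hp : ∀ a ∈ p.support, ∀ i, a i ≤ A) :
    ∫ a, totalCount a ∂p.toMeasure = ∑ i, meanVec p i := by
  unfold totalCount meanVec
  exact integral_finsetSum _ fun i _ => p.integrable_of_bounded _ A fun a ha => by
    simpa using hp a ha i

lemma hadamardSum_covMatrix {p : PMF (ι → ℕ)} {A : ℕ} (hp : ∀ a ∈ p.support, ∀ i, a i ≤ A) :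
    hadamardSum (onesMatrix ι ι) (covMatrix p) = Var[totalCount; p.toMeasure] := by
  have := variance_fun_sum (μ := p.toMeasure) (X := fun (i : ι) (a : ι → ℕ) => (a i : ℝ))
    fun i => p.memLp_of_bounded _ A 2 fun a ha => by simpa using hp a ha i
  unfold totalCount
  rw [this]
  simp [hadamardSum, onesMatrix, covMatrix]

/-- The variance of the total is Lipschitz in the mean vector along couplings that are ordered in
each coordinate: the order turns the mean of `|a i - a' i|` into the difference of the means. -/
lemma variance_totalCount_le_of_coupling {p p' : PMF (ι → ℕ)} {A : ℕ}
    (hp : ∀ a ∈ p.support, ∀ i, a i ≤ A) (hp' : ∀ a ∈ p'.support, ∀ i, a i ≤ A)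
    (ρ : PMF ((ι → ℕ) × (ι → ℕ))) (h1 : ρ.map Prod.fst = p) (h2 : ρ.map Prod.snd = p')
    (hord : ∀ i, (∀ w ∈ ρ.support, w.1 i ≤ w.2 i) ∨ ∀ w ∈ ρ.support, w.2 i ≤ w.1 i)
    {ε : ℝ} (hε : ∀ i, |meanVec p i - meanVec p' i| ≤ ε) :
    Var[totalCount; p'.toMeasure] ≤
      Var[totalCount; p.toMeasure] + 4 * (Fintype.card ι : ℝ) ^ 2 * A * ε := by
  set N : ℝ := (Fintype.card ι : ℝ) with hN
  have hs1 : ∀ w ∈ ρ.support, ∀ i, w.1 i ≤ A := fun w hw =>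
    hp _ (h1 ▸ (PMF.mem_support_map_iff _ _ _).2 ⟨w, hw, rfl⟩)
  have hs2 : ∀ w ∈ ρ.support, ∀ i, w.2 i ≤ A := fun w hw =>
    hp' _ (h2 ▸ (PMF.mem_support_map_iff _ _ _).2 ⟨w, hw, rfl⟩)
  have m1 : p.toMeasure = ρ.toMeasure.map Prod.fst := by
    rw [PMF.toMeasure_map _ _ measurable_fst, h1]
  have m2 : p'.toMeasure = ρ.toMeasure.map Prod.snd := by
    rw [PMF.toMeasure_map _ _ measurable_snd, h2]
  set T : (ι → ℕ) × (ι → ℕ) → ℝ := fun w => totalCount w.1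
  set T' : (ι → ℕ) × (ι → ℕ) → ℝ := fun w => totalCount w.2
  have v1 : Var[totalCount; p.toMeasure] = Var[T; ρ.toMeasure] := by
    rw [m1, variance_map Measurable.of_discrete.aemeasurable measurable_fst.aemeasurable]; rfl
  have v2 : Var[totalCount; p'.toMeasure] = Var[T'; ρ.toMeasure] := by
    rw [m2, variance_map Measurable.of_discrete.aemeasurable measurable_snd.aemeasurable]; rfl
  have bT : ∀ w ∈ ρ.support, |T w| ≤ N * A := fun w hw => abs_totalCount_le (hs1 w hw)
  have bT' : ∀ w ∈ ρ.support, |T' w| ≤ N * A := fun w hw => abs_totalCount_le (hs2 w hw)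
  have lT := ρ.memLp_of_bounded T _ 2 bT
  have lT' := ρ.memLp_of_bounded T' _ 2 bT'
  have iT := ρ.integrable_of_bounded T _ bT
  have iT' := ρ.integrable_of_bounded T' _ bT'
  have c1 : ∀ i, Integrable (fun w : (ι → ℕ) × (ι → ℕ) => (w.1 i : ℝ)) ρ.toMeasure := fun i =>
    ρ.integrable_of_bounded _ A fun w hw => by simpa using hs1 w hw i
  have c2 : ∀ i, Integrable (fun w : (ι → ℕ) × (ι → ℕ) => (w.2 i : ℝ)) ρ.toMeasure := fun i =>
    ρ.integrable_of_bounded _ A fun w hw => by simpa using hs2 w hw i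
  have mean1 : ∀ i, meanVec p i = ∫ w, (w.1 i : ℝ) ∂ρ.toMeasure := fun i => by
    rw [meanVec, m1, integral_map measurable_fst.aemeasurable
      Measurable.of_discrete.aestronglyMeasurable]
  have mean2 : ∀ i, meanVec p' i = ∫ w, (w.2 i : ℝ) ∂ρ.toMeasure := fun i => by
    rw [meanVec, m2, integral_map measurable_snd.aemeasurable
      Measurable.of_discrete.aestronglyMeasurable]
  have coord : ∀ i, ∫ w, |(w.1 i : ℝ) - w.2 i| ∂ρ.toMeasure ≤ ε := by
    intro i
    refine le_trans ?_ (hε i)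
    rw [mean1, mean2, ← integral_sub (c1 i) (c2 i)]
    rcases hord i with h | h
    · refine le_trans (le_of_eq ?_) (neg_le_abs _)
      rw [← integral_neg]
      refine integral_congr_ae (ρ.ae_mem_support.mono fun w hw => abs_of_nonpos ?_)
      simpa using h w hw
    · refine le_trans (le_of_eq ?_) (le_abs_self _)
      refine integral_congr_ae (ρ.ae_mem_support.mono fun w hw => abs_of_nonneg ?_)
      simpa using h w hw
  have ci : ∀ i, Integrable (fun w : (ι → ℕ) × (ι → ℕ) => |(w.1 i : ℝ) - w.2 i|) ρ.toMeasure :=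
    fun i => ((c1 i).sub (c2 i)).abs
  have dist : ∫ w, |T w - T' w| ∂ρ.toMeasure ≤ N * ε := by
    calc ∫ w, |T w - T' w| ∂ρ.toMeasure
        ≤ ∫ w, ∑ i, |(w.1 i : ℝ) - w.2 i| ∂ρ.toMeasure := by
          refine integral_mono (iT.sub iT').abs (integrable_finsetSum _ fun i _ => ci i) ?_
          intro w
          simp only [T, T', totalCount, ← Finset.sum_sub_distrib]
          exact Finset.abs_sum_le_sum_abs _ _
      _ = ∑ i, ∫ w, |(w.1 i : ℝ) - w.2 i| ∂ρ.toMeasure := integral_finsetSum _ fun i _ => ci i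
      _ ≤ N * ε := by
          have := Finset.sum_le_card_nsmul Finset.univ _ ε fun i _ => coord i
          simpa [hN] using this
  have hNA : 0 ≤ N * A := by positivity
  have sq : ∫ w, T' w ^ 2 ∂ρ.toMeasure - ∫ w, T w ^ 2 ∂ρ.toMeasure ≤ 2 * (N * A) * (N * ε) := by
    rw [← integral_sub lT'.integrable_sq lT.integrable_sq]
    refine le_trans ?_ (mul_le_mul_of_nonneg_left dist (by positivity))
    rw [← integral_const_mul]
    refine integral_mono_ae (lT'.integrable_sq.sub lT.integrable_sq)
      ((iT.sub iT').abs.const_mul _) (ρ.ae_mem_support.mono fun w hw => ?_)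
    have e1 : |T w + T' w| ≤ 2 * (N * A) := by
      linarith [abs_add_le (T w) (T' w), bT w hw, bT' w hw]
    calc T' w ^ 2 - T w ^ 2 = -((T w + T' w) * (T w - T' w)) := by ring
      _ ≤ |(T w + T' w) * (T w - T' w)| := neg_le_abs _
      _ = |T w + T' w| * |T w - T' w| := abs_mul _ _
      _ ≤ 2 * (N * A) * |T w - T' w| := mul_le_mul_of_nonneg_right e1 (abs_nonneg _)
  have meanb : ∀ U : (ι → ℕ) × (ι → ℕ) → ℝ, (∀ w ∈ ρ.support, |U w| ≤ N * A) →
      |∫ w, U w ∂ρ.toMeasure| ≤ N * A := fun U hU => by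
    have := norm_integral_le_of_norm_le_const (μ := ρ.toMeasure) (f := U) (C := N * A)
      (ρ.ae_mem_support.mono hU)
    simpa using this
  have diffb : |∫ w, T w ∂ρ.toMeasure - ∫ w, T' w ∂ρ.toMeasure| ≤ N * ε := by
    rw [← integral_sub iT iT']
    exact (abs_integral_le_integral_abs).trans dist
  have msq : (∫ w, T w ∂ρ.toMeasure) ^ 2 - (∫ w, T' w ∂ρ.toMeasure) ^ 2 ≤
      2 * (N * A) * (N * ε) := by
    have a1 := meanb T bT
    have a2 := meanb T' bT'
    set x := ∫ w, T w ∂ρ.toMeasure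
    set y := ∫ w, T' w ∂ρ.toMeasure
    calc x ^ 2 - y ^ 2 = (x + y) * (x - y) := by ring
      _ ≤ |(x + y) * (x - y)| := le_abs_self _
      _ = |x + y| * |x - y| := abs_mul _ _
      _ ≤ 2 * (N * A) * (N * ε) :=
        mul_le_mul (by linarith [abs_add_le x y]) diffb (abs_nonneg _) (by positivity)
  rw [v1, v2, variance_eq_sub lT, variance_eq_sub lT']
  simp only [Pi.pow_apply]
  nlinarith

end Totals

/-! ### The imbalance of the two sides of the market -/

section Imbalance

variable {n m : ℕ}

/-- The total server queue length minus the total customer queue length. Matching leaves it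
unchanged, whatever the policy does. -/
def imbalance (q : QState n m) : ℝ := totalCount q.1 - totalCount q.2

lemma abs_imbalance_le (q : QState n m) : |imbalance q| ≤ totalCount q.1 + totalCount q.2 := by
  have h1 := totalCount_nonneg q.1
  have h2 := totalCount_nonneg q.2
  exact abs_le.2 ⟨by unfold imbalance; linarith, by unfold imbalance; linarith⟩

lemma tsum_mul_abs_imbalance_le (ψ : PMF (QState n m)) :
    ∑' q, ψ q * ENNReal.ofReal |imbalance q| ≤ expectedTotalQueue ψ := by
  refine ENNReal.tsum_le_tsum fun q => mul_le_mul_right ?_ _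
  refine (ENNReal.ofReal_le_ofReal (abs_imbalance_le q)).trans (le_of_eq ?_)
  rw [ENNReal.ofReal_add (totalCount_nonneg _) (totalCount_nonneg _)]
  unfold totalCount
  rw [ENNReal.ofReal_sum_of_nonneg fun _ _ => Nat.cast_nonneg _,
    ENNReal.ofReal_sum_of_nonneg fun _ _ => Nat.cast_nonneg _]
  simp

namespace Policy

variable {M : ServerMarket n} {E : Set (Fin n × Fin m)} {A : ℕ}

lemma imbalance_next (π : Policy M E A) (q a : QState n m) :
    imbalance (π.next q a) = imbalance q + imbalance a := by
  have h1 : totalCount (π.next q a).1 =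
      totalCount q.1 + totalCount a.1 - ∑ i, ∑ j, (π.matching q a i j : ℝ) := by
    simp only [totalCount, next]
    rw [← Finset.sum_add_distrib, ← Finset.sum_sub_distrib]
    refine Finset.sum_congr rfl fun i _ => ?_
    rw [Nat.cast_sub (π.server_matched_le q a i)]
    push_cast
    rfl
  have h2 : totalCount (π.next q a).2 =
      totalCount q.2 + totalCount a.2 - ∑ i, ∑ j, (π.matching q a i j : ℝ) := by
    simp only [totalCount, next]
    rw [Finset.sum_comm, ← Finset.sum_add_distrib, ← Finset.sum_sub_distrib]
    refine Finset.sum_congr rfl fun j _ => ?_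
    rw [Nat.cast_sub (π.customer_matched_le q a j)]
    push_cast
    rfl
  unfold imbalance
  rw [h1, h2]
  ring

variable (π : Policy M E A) (arr : ArrivalModel M m A) (q : QState n m)

lemma abs_imbalance_arrival_le {a : QState n m} (ha : a ∈ (π.arrivalLaw arr q).support) :
    |imbalance a| ≤ n * A + m * A := by
  obtain ⟨a₁, h₁, h⟩ := (PMF.mem_support_bind_iff _ _ _).1 ha
  obtain ⟨a₂, h₂, rfl⟩ := (PMF.mem_support_map_iff _ _ _).1 h
  have e1 := totalCount_le (arr.server_le _ (π.server_attainable q) a₁ h₁)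
  have e2 := totalCount_le (arr.customer_le _ (π.customer_attainable q) a₂ h₂)
  rw [Fintype.card_fin] at e1 e2
  exact (abs_imbalance_le _).trans (add_le_add e1 e2)

lemma abs_imbalance_step_le {y : QState n m} (hy : y ∈ (π.kernel arr q).support) :
    |imbalance y - imbalance q| ≤ n * A + m * A := by
  obtain ⟨a, ha, rfl⟩ := (PMF.mem_support_map_iff _ _ _).1 hy
  rw [imbalance_next, add_sub_cancel_left]
  exact π.abs_imbalance_arrival_le arr q ha

lemma integral_kernel_imbalance (f : ℝ → ℝ) :
    ∫ y, f (imbalance y - imbalance q) ∂(π.kernel arr q).toMeasure =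
      ∫ a, f (imbalance a) ∂((arr.server (π.serverPricing q)).toMeasure.prod
        (arr.customer (π.customerRate q)).toMeasure) := by
  rw [← PMF.toMeasure_bind_map_mk, kernel, ← PMF.toMeasure_map _ _ Measurable.of_discrete,
    integral_map Measurable.of_discrete.aemeasurable Measurable.of_discrete.aestronglyMeasurable]
  simp only [imbalance_next, add_sub_cancel_left]
  rfl

lemma memLp_server :
    MemLp totalCount 2 (arr.server (π.serverPricing q)).toMeasure :=
  PMF.memLp_of_bounded _ _ _ _ fun a ha =>
    abs_totalCount_le (arr.server_le _ (π.server_attainable q) a ha)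

lemma memLp_customer :
    MemLp totalCount 2 (arr.customer (π.customerRate q)).toMeasure :=
  PMF.memLp_of_bounded _ _ _ _ fun a ha =>
    abs_totalCount_le (arr.customer_le _ (π.customer_attainable q) a ha)

lemma integral_imbalance_step :
    ∫ y, (imbalance y - imbalance q) ∂(π.kernel arr q).toMeasure =
      ∑ i, meanRate (π.serverPricing q) i - ∑ j, π.customerRate q j := by
  rw [π.integral_kernel_imbalance arr q fun x => x]
  unfold imbalance
  rw [integral_sub (((π.memLp_server arr q).integrable (by norm_num)).comp_fst _)
    (((π.memLp_customer arr q).integrable (by norm_num)).comp_snd _),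
    integral_fun_fst (fun a : Fin n → ℕ => totalCount a),
    integral_fun_snd (fun a : Fin m → ℕ => totalCount a),
    integral_totalCount (arr.server_le _ (π.server_attainable q)),
    integral_totalCount (arr.customer_le _ (π.customer_attainable q))]
  simp [arr.server_mean _ (π.server_attainable q), arr.customer_mean _ (π.customer_attainable q)]

/-- The second moment of a step of the imbalance dominates its variance, which splits into the
server part and the customer part because the two sides are independent. -/
lemma variance_le_integral_imbalance_step_sq :
    Var[totalCount; (arr.server (π.serverPricing q)).toMeasure] +
        Var[totalCount; (arr.customer (π.customerRate q)).toMeasure] ≤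
      ∫ y, (imbalance y - imbalance q) ^ 2 ∂(π.kernel arr q).toMeasure := by
  rw [π.integral_kernel_imbalance arr q fun x => x ^ 2]
  have hv := variance_add_prod (π.memLp_server arr q) (π.memLp_customer arr q).neg
  rw [variance_neg] at hv
  rw [← hv]
  refine (variance_le_expectation_sq Measurable.of_discrete.aestronglyMeasurable).trans
    (le_of_eq ?_)
  simp [imbalance, sub_eq_add_neg]

end Policy

end Imbalance

/-! ### The lower bound on the queue lengths -/

lemma FluidFeasible.sum_meanRate_eq {n m : ℕ} {M : ServerMarket n} {E : Set (Fin n × Fin m)}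
    {lam : Fin m → ℝ} {α : ProbabilityMeasure M.rates} {χ : Fin n → Fin m → ℝ}
    (h : FluidFeasible M E lam α χ) : ∑ i, meanRate α i = ∑ j, lam j := by
  simp_rw [h.server_balance, h.customer_balance]
  exact Finset.sum_comm

lemma abs_sum_sub_sum_le_card_mul {ι : Type*} [Fintype ι] {x y : ι → ℝ} {ε : ℝ}
    (h : ∀ i, |x i - y i| ≤ ε) : |∑ i, x i - ∑ i, y i| ≤ Fintype.card ι * ε := by
  rw [← Finset.sum_sub_distrib]
  refine (Finset.abs_sum_le_sum_abs _ _).trans ?_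
  simpa using Finset.sum_le_card_nsmul Finset.univ _ ε fun i _ => h i

theorem mainTheorem3 {n m : ℕ} (E : Set (Fin n × Fin m)) (F : Fin m → ℝ → ℝ)
    (M : ServerMarket n) (A : ℕ) (arr : ArrivalModel M m A) (hmono : arr.ServerMonotone)
    (lamStar : Fin m → ℝ) (αStar : ProbabilityMeasure M.rates) (χStar : Fin n → Fin m → ℝ)
    (hopt : FluidOptimal F M E lamStar αStar χStar) (hatt : ServerAttainable A αStar)
    (SigmaMin : Matrix (Fin m) (Fin m) ℝ) :
    ∃ ε₀ : ℝ, 0 < ε₀ ∧ ∀ ε : ℝ, 0 < ε → ε < ε₀ →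
      ∀ (π : Policy M E A) (S : Set (QState n m)), π.Stable arr S →
        (∀ q ∈ S, ∀ j l, SigmaMin j l ≤ covMatrix (arr.customer (π.customerRate q)) j l) →
        (∀ q ∈ S, ∀ j, |π.customerRate q j - lamStar j| ≤ ε) →
        (∀ q ∈ S, ∀ i, |meanRate (π.serverPricing q) i - meanRate αStar i| ≤ ε) →
        ∀ ψ : PMF (QState n m), DTMC.IsStationaryOn (π.kernel arr) S ψ →
          ENNReal.ofReal
            ((hadamardSum (onesMatrix (Fin n) (Fin n)) (covMatrix (arr.server αStar)) +
                hadamardSum (onesMatrix (Fin m) (Fin m)) SigmaMin) /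
              (8 * (max m n : ℕ) * ε))
            ≤ expectedTotalQueue ψ := by
  set V := hadamardSum (onesMatrix (Fin n) (Fin n)) (covMatrix (arr.server αStar)) with hV
  set W := hadamardSum (onesMatrix (Fin m) (Fin m)) SigmaMin with hW
  by_cases hVW : V + W ≤ 0
  -- A nonpositive bound is truncated to zero by `ENNReal.ofReal`.
  · refine ⟨1, one_pos, fun ε hε _ π S _ _ _ _ ψ _ => ?_⟩
    rw [ENNReal.ofReal_of_nonpos (div_nonpos_of_nonpos_of_nonneg hVW (by positivity))]
    exact zero_le
  rw [not_le] at hVW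
  -- Below this `ε₀` the Lipschitz bound on the server variance loses at most `(V + W) / 2`.
  set C : ℝ := 4 * (n : ℝ) ^ 2 * A with hC
  have hC0 : 0 ≤ C := by positivity
  refine ⟨(V + W) / (2 * (C + 1)), by positivity, ?_⟩
  intro ε hε hεlt π S _ hcov hlam hmean ψ hψ
  have hCε : C * ε ≤ (V + W) / 2 := by
    rw [lt_div_iff₀ (by positivity)] at hεlt
    nlinarith
  have hnm : 0 < n + m := by
    by_contra h
    obtain ⟨rfl, rfl⟩ : n = 0 ∧ m = 0 := by omega
    simp [V, W, hadamardSum] at hVW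
  have hnm' : (0 : ℝ) < (n : ℝ) + m := by exact_mod_cast hnm
  have hdrift : ∀ q ∈ ψ.support,
      |∫ y, (imbalance y - imbalance q) ∂(π.kernel arr q).toMeasure| ≤ (n + m) * ε := by
    intro q hq
    have hqS := hψ.1 hq
    rw [π.integral_imbalance_step arr q]
    have h1 := abs_sum_sub_sum_le_card_mul (hmean q hqS)
    have h2 := abs_sum_sub_sum_le_card_mul (hlam q hqS)
    rw [Fintype.card_fin] at h1 h2
    rw [abs_le] at *
    have h3 := hopt.1.sum_meanRate_eq
    constructor <;> linarith
  have hvar : ∀ q ∈ ψ.support, (V + W) / 2 ≤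
      ∫ y, (imbalance y - imbalance q) ^ 2 ∂(π.kernel arr q).toMeasure := by
    intro q hq
    have hqS := hψ.1 hq
    have hsv := π.server_attainable q
    have hcu := π.customer_attainable q
    refine le_trans ?_ (π.variance_le_integral_imbalance_step_sq arr q)
    have h2 : W ≤ Var[totalCount; (arr.customer (π.customerRate q)).toMeasure] := by
      rw [← hadamardSum_covMatrix (arr.customer_le _ hcu), hW]
      unfold hadamardSum
      gcongr with j _ l _
      · simp [onesMatrix]
      · exact hcov q hqS j l
    have h1 : V ≤ Var[totalCount; (arr.server (π.serverPricing q)).toMeasure] + C * ε := by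
      rw [hV, hadamardSum_covMatrix (arr.server_le _ hatt)]
      obtain ⟨ρ, hρ1, hρ2, hρ⟩ := hmono _ _ hsv hatt
      have := variance_totalCount_le_of_coupling (arr.server_le _ hsv) (arr.server_le _ hatt)
        ρ hρ1 hρ2 (ε := ε) (fun i => ?_) (fun i => ?_)
      · simpa [hC] using this
      · rcases le_total (meanRate (π.serverPricing q) i) (meanRate αStar i) with h | h
        · exact Or.inl fun w hw => (hρ w hw i).1 h
        · exact Or.inr fun w hw => (hρ w hw i).2 h
      · rw [arr.server_mean _ hsv, arr.server_mean _ hatt]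
        exact hmean q hqS i
    linarith
  have main := PMF.div_two_mul_le_mean_abs_of_bind_eq (π.kernel arr) ψ hψ.2 imbalance
    (B := n * A + m * A) (by positivity) (mul_pos hnm' hε)
    (fun q _ y hy => π.abs_imbalance_step_le arr q hy) hdrift hvar (by linarith)
  refine le_trans (ENNReal.ofReal_le_ofReal ?_) (main.trans (tsum_mul_abs_imbalance_le ψ))
  -- The bound obtained is `(V + W) / (4 (n + m) ε)`.
  have hmax : (n : ℝ) + m ≤ 2 * (max m n : ℕ) := by
    have : n + m ≤ 2 * max m n := by omega
    exact_mod_cast this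
  rw [div_div]
  refine div_le_div_of_nonneg_left hVW.le (by positivity) ?_
  nlinarith
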